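/- For each positive integer $l$ let $T_l$ be the rooted complete ternary tree with $l$ layers, that is, each non-leaf node has exactly $3$ children and each root-to-leaf path has exactly $l$ nodes; let $n = n(l)$ be its number of nodes. The $w \times h$ grid has as its nodes the $wh$ integer points $(x,y)$ with $0 \le x < w$ and $0 \le y < h$, and its area is $wh$. A straight-line orthogonal drawing of a tree in this grid maps the vertices of the tree to distinct grid nodes and each edge to a horizontal or vertical segment between the images of its endpoints, such that a segment contains the image of no vertex other than the endpoints of its edge, and the segments of two distinct edges meet at most in the image of a common endpoint. Such a drawing of $T_l$ satisfies the subtree separation property if, for all nodes $a$ and $b$ of $T_l$ such that the subtrees rooted at $a$ and $b$ have no node in common, the smallest axis-aligned rectangles containing the drawn nodes of these two subtrees have no grid node in common. Then the complete ternary tree with $n$ nodes has a straight-line orthogonal drawing that satisfies the subtree separation property and has area $O(n^{1.032})$: there is a constant $C$ such that for every $l \ge 1$ there are $w$, $h$ and a straight-line orthogonal drawing of $T_l$ in the $w \times h$ grid that satisfies the subtree separation property, with $wh \le C\, n(l)^{1.032}$. -/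

import Mathlib

/-- The node set of the complete ternary tree `T_l` with `l` layers.  A node is the list of the
choices of child (first choice first) on the path that leads to it from the root, which is `[]`.
The nodes in the last layer are the lists of length `l - 1`; for `l = 0` there is no node. -/
abbrev TernaryNode (l : ℕ) : Type := {p : List (Fin 3) // p.length < l}

instance (l : ℕ) : Finite (TernaryNode l) :=
  (List.finite_length_lt (Fin 3) l).to_subtype

/-- `q` is one of the three children of `p`. -/
def TernaryNode.IsChild {l : ℕ} (p q : TernaryNode l) : Prop :=
  ∃ i : Fin 3, q.1 = p.1 ++ [i]

/-- The complete ternary tree `T_l`, as a graph: its edges join each node to its children. -/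
def completeTernaryTree (l : ℕ) : SimpleGraph (TernaryNode l) where
  Adj p q := p.IsChild q ∨ q.IsChild p
  symm := ⟨fun _ _ h => Or.symm h⟩
  loopless := ⟨fun p h => by
    rcases h with ⟨i, hi⟩ | ⟨i, hi⟩ <;> simpa using congrArg List.length hi⟩

/-- The nodes of the subtree of `T_l` rooted at `a`: the node `a` and all its descendants. -/
def TernaryNode.subtree {l : ℕ} (a : TernaryNode l) : Set (TernaryNode l) :=
  {b | a.1 <+: b.1}

/-- The grid nodes on the grid path from `a` to `b`, for two grid nodes `a` and `b` on a common
horizontal or vertical grid line: `Set.uIcc a b` is the coordinatewise (closed) box spanned by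
`a` and `b`, which in this case is just the segment between them. -/
def gridSegment (a b : ℤ × ℤ) : Set (ℤ × ℤ) := Set.uIcc a b

/-- A straight-line orthogonal drawing of a graph in the `w × h` grid, whose nodes are the `w * h`
points `(x, y)` with integers `0 ≤ x < w` and `0 ≤ y < h`.  Each edge is drawn as a single
horizontal or vertical segment, and drawings of distinct edges meet only in the image of a common
endpoint.  (Segments with ends in the grid that lie on grid lines can only meet in a grid node
or along a whole segment that has its ends in the grid, so it suffices to speak of grid nodes.) -/
structure StraightLineOrthogonalDrawing {V : Type*} (G : SimpleGraph V) (w h : ℕ) where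
  /-- The position of each vertex. -/
  pos : V → ℤ × ℤ
  pos_injective : Function.Injective pos
  mem_grid : ∀ v, 0 ≤ (pos v).1 ∧ (pos v).1 < w ∧ 0 ≤ (pos v).2 ∧ (pos v).2 < h
  aligned : ∀ u v, G.Adj u v → (pos u).1 = (pos v).1 ∨ (pos u).2 = (pos v).2
  vertex_on_edge : ∀ u v, G.Adj u v → ∀ x, pos x ∈ gridSegment (pos u) (pos v) → x = u ∨ x = v
  edges_meet : ∀ u v u' v', G.Adj u v → G.Adj u' v' → s(u, v) ≠ s(u', v') →
    ∀ q ∈ gridSegment (pos u) (pos v) ∩ gridSegment (pos u') (pos v'),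
      ∃ x, x ∈ s(u, v) ∧ x ∈ s(u', v') ∧ pos x = q

/-- The grid nodes in the smallest axis-aligned rectangle that contains the (finite) set `s`. -/
def boundingRectangle (s : Set (ℤ × ℤ)) : Set (ℤ × ℤ) :=
  {q | (∃ a ∈ s, a.1 ≤ q.1) ∧ (∃ b ∈ s, q.1 ≤ b.1) ∧ (∃ c ∈ s, c.2 ≤ q.2) ∧ (∃ d ∈ s, q.2 ≤ d.2)}

/-- The subtree separation property: whenever the subtrees rooted at `a` and `b` have no node in
common, their bounding rectangles have no grid node in common. -/
def SubtreeSeparated {l w h : ℕ}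
    (Γ : StraightLineOrthogonalDrawing (completeTernaryTree l) w h) : Prop :=
  ∀ a b : TernaryNode l, Disjoint a.subtree b.subtree →
    Disjoint (boundingRectangle (Γ.pos '' a.subtree)) (boundingRectangle (Γ.pos '' b.subtree))

/-! A drawing of `T_{l+1}` is assembled at a root placed at the origin: two copies of one drawing of
`T_l`, turned by a quarter, go to the left and right with their tops facing the root, and a possibly
different drawing of `T_l` goes upright underneath. If the upward ray from the root is free in the
parts, the three new edges hit nothing, and the new root again has a free upward ray
(`IsSeparatedDrawing.join`, `HasDrawing.join`). Let `x` be the number of columns on either side of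
the root plus one, and `y` the number of rows plus one. With the lower subtree below the side ones,
`(x₁, y₁)` and `(x₃, y₃)` yield `(max y₁ x₃, 2x₁ + y₃)`; with it between them they yield `(x₃ + y₁,
x₁ + y₃)`, provided `x₁ ≤ y₃`. Thanks to the added ones these rules are homogeneous. A single shape
does not reproduce itself, so the induction carries a whole convex region `R` of shapes: if all of
`c • R` is attainable for `T_l`, then all of `(c * growth) • R` is attainable for `T_{l+1}`
(`DrawableOn.succ`). The rules are linear inequalities, so by convexity it is enough to certify the
vertices of a polygonal line below `R` (`exists_chord_le`), a finite integer computation. One point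
of `R` then gives area `O(growth ^ (2 * l))`, and `growth ^ 2 ≤ 3 ^ 1.032`. -/

/-! ### Grid segments and separation by lines. -/

theorem mem_gridSegment {a b q : ℤ × ℤ} : q ∈ gridSegment a b ↔
    (min a.1 b.1 ≤ q.1 ∧ q.1 ≤ max a.1 b.1) ∧ (min a.2 b.2 ≤ q.2 ∧ q.2 ≤ max a.2 b.2) := by
  simp only [gridSegment, Set.uIcc, Set.mem_Icc, Prod.le_def, Prod.fst_inf, Prod.snd_inf,
    Prod.fst_sup, Prod.snd_sup]
  tauto

theorem left_mem_gridSegment (a b : ℤ × ℤ) : a ∈ gridSegment a b := Set.left_mem_uIcc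

theorem gridSegment_comm (a b : ℤ × ℤ) : gridSegment a b = gridSegment b a := Set.uIcc_comm a b

/-- Some horizontal or vertical line strictly separates the sets `A` and `B`. -/
def Apart (A B : Set (ℤ × ℤ)) : Prop :=
  (∀ p ∈ A, ∀ q ∈ B, p.1 < q.1) ∨ (∀ p ∈ A, ∀ q ∈ B, q.1 < p.1) ∨
    (∀ p ∈ A, ∀ q ∈ B, p.2 < q.2) ∨ (∀ p ∈ A, ∀ q ∈ B, q.2 < p.2)

theorem Apart.mono {A B A' B' : Set (ℤ × ℤ)} (h : Apart A B) (hA : A' ⊆ A) (hB : B' ⊆ B) :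
    Apart A' B' := by
  rcases h with h | h | h | h
  · exact Or.inl fun p hp q hq => h p (hA hp) q (hB hq)
  · exact Or.inr (Or.inl fun p hp q hq => h p (hA hp) q (hB hq))
  · exact Or.inr (Or.inr (Or.inl fun p hp q hq => h p (hA hp) q (hB hq)))
  · exact Or.inr (Or.inr (Or.inr fun p hp q hq => h p (hA hp) q (hB hq)))

theorem Apart.symm {A B : Set (ℤ × ℤ)} (h : Apart A B) : Apart B A := by
  rcases h with h | h | h | h
  · exact Or.inr (Or.inl fun p hp q hq => h q hq p hp)
  · exact Or.inl fun p hp q hq => h q hq p hp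
  · exact Or.inr (Or.inr (Or.inr fun p hp q hq => h q hq p hp))
  · exact Or.inr (Or.inr (Or.inl fun p hp q hq => h q hq p hp))

theorem Apart.disjoint {A B : Set (ℤ × ℤ)} (h : Apart A B) : Disjoint A B := by
  rw [Set.disjoint_left]
  intro p hA hB
  rcases h with h | h | h | h <;> exact lt_irrefl _ (h p hA p hB)

/-- A separating line also separates the bounding rectangles, so the induction can carry `Apart` and
never mention rectangles. -/
theorem Apart.disjoint_boundingRectangle {A B : Set (ℤ × ℤ)} (h : Apart A B) :
    Disjoint (boundingRectangle A) (boundingRectangle B) := by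
  rw [Set.disjoint_left]
  rintro q ⟨⟨a, ha, haq⟩, ⟨b, hb, hqb⟩, ⟨c, hc, hcq⟩, ⟨d, hd, hqd⟩⟩
    ⟨⟨a', ha', haq'⟩, ⟨b', hb', hqb'⟩, ⟨c', hc', hcq'⟩, ⟨d', hd', hqd'⟩⟩
  rcases h with h | h | h | h
  · have := h b hb a' ha'; omega
  · have := h a ha b' hb'; omega
  · have := h d hd c' hc'; omega
  · have := h c hc d' hd'; omega

/-! ### Separated drawings and maps that preserve them. -/

/-- A straight-line orthogonal drawing of the complete ternary tree with `l` layers that satisfies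
the subtree separation property, as a map on all lists of which only the lists shorter than `l`
matter. -/
structure IsSeparatedDrawing (l : ℕ) (pos : List (Fin 3) → ℤ × ℤ) : Prop where
  inj : ∀ p q, p.length < l → q.length < l → pos p = pos q → p = q
  aligned : ∀ p i, p.length + 1 < l →
    (pos p).1 = (pos (p ++ [i])).1 ∨ (pos p).2 = (pos (p ++ [i])).2
  vertex_on_edge : ∀ p i x, p.length + 1 < l → x.length < l →
    pos x ∈ gridSegment (pos p) (pos (p ++ [i])) → x = p ∨ x = p ++ [i]
  edges_meet : ∀ p i p' i', p.length + 1 < l → p'.length + 1 < l → p ++ [i] ≠ p' ++ [i'] →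
    ∀ q, q ∈ gridSegment (pos p) (pos (p ++ [i])) → q ∈ gridSegment (pos p') (pos (p' ++ [i'])) →
      ∃ x, (x = p ∨ x = p ++ [i]) ∧ (x = p' ∨ x = p' ++ [i']) ∧ pos x = q
  apart : ∀ a b : List (Fin 3), ¬ a <+: b → ¬ b <+: a →
    Apart (pos '' {p | a <+: p ∧ p.length < l}) (pos '' {p | b <+: p ∧ p.length < l})

/-- An embedding of the grid into itself that respects its horizontal and vertical lines. -/
structure IsGridEmbedding (T : ℤ × ℤ → ℤ × ℤ) : Prop where
  injective : Function.Injective T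
  aligned : ∀ a b, (a.1 = b.1 ∨ a.2 = b.2) → (T a).1 = (T b).1 ∨ (T a).2 = (T b).2
  segment : ∀ a b q, q ∈ gridSegment (T a) (T b) → ∃ q', T q' = q ∧ q' ∈ gridSegment a b
  apart : ∀ A B, Apart A B → Apart (T '' A) (T '' B)

theorem isGridEmbedding_translate (a b : ℤ) :
    IsGridEmbedding fun p => (p.1 + a, p.2 + b) where
  injective := by
    rintro ⟨x, y⟩ ⟨x', y'⟩ h
    simp only [Prod.mk.injEq] at h ⊢
    omega
  aligned p q h := by simp only; omega
  segment p q r h := by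
    refine ⟨(r.1 - a, r.2 - b), by simp, ?_⟩
    rw [mem_gridSegment] at h ⊢
    simp only at h ⊢
    omega
  apart A B h := by
    simp only [Apart, Set.forall_mem_image] at h ⊢
    simpa using h

/-- Up becomes right, as needed for the left subtree. The map is a reflection in a diagonal;
orientation plays no role. -/
theorem isGridEmbedding_rotate_right (a : ℤ) :
    IsGridEmbedding fun p => (p.2 + a, p.1) where
  injective := by
    rintro ⟨x, y⟩ ⟨x', y'⟩ h
    simp only [Prod.mk.injEq] at h ⊢
    omega
  aligned p q h := by simp only; omega
  segment p q r h := by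
    refine ⟨(r.2, r.1 - a), by simp, ?_⟩
    rw [mem_gridSegment] at h ⊢
    simp only at h ⊢
    omega
  apart A B h := by
    simp only [Apart, Set.forall_mem_image, add_lt_add_iff_right] at h ⊢
    tauto

theorem isGridEmbedding_rotate_left (a : ℤ) :
    IsGridEmbedding fun p => (a - p.2, p.1) where
  injective := by
    rintro ⟨x, y⟩ ⟨x', y'⟩ h
    simp only [Prod.mk.injEq] at h ⊢
    omega
  aligned p q h := by simp only; omega
  segment p q r h := by
    refine ⟨(r.2, a - r.1), by simp, ?_⟩
    rw [mem_gridSegment] at h ⊢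
    simp only at h ⊢
    omega
  apart A B h := by
    simp only [Apart, Set.forall_mem_image, sub_lt_sub_iff_left] at h ⊢
    tauto

theorem IsGridEmbedding.mem_segment {T : ℤ × ℤ → ℤ × ℤ} (hT : IsGridEmbedding T) {a b q : ℤ × ℤ}
    (h : T q ∈ gridSegment (T a) (T b)) : q ∈ gridSegment a b := by
  obtain ⟨q', hq, hm⟩ := hT.segment _ _ _ h
  rwa [← hT.injective hq]

theorem IsSeparatedDrawing.comp {l : ℕ} {pos : List (Fin 3) → ℤ × ℤ}
    (h : IsSeparatedDrawing l pos) {T : ℤ × ℤ → ℤ × ℤ} (hT : IsGridEmbedding T) :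
    IsSeparatedDrawing l (fun p => T (pos p)) where
  inj p q hp hq e := h.inj p q hp hq (hT.injective e)
  aligned p i hp := hT.aligned _ _ (h.aligned p i hp)
  vertex_on_edge p i x hp hx hm := h.vertex_on_edge p i x hp hx (hT.mem_segment hm)
  edges_meet p i p' i' hp hp' hne q hq hq' := by
    obtain ⟨r, rfl, hr⟩ := hT.segment _ _ _ hq
    obtain ⟨x, h1, h2, rfl⟩ := h.edges_meet p i p' i' hp hp' hne r hr (hT.mem_segment hq')
    exact ⟨x, h1, h2, rfl⟩
  apart a b hab hba := by
    have := hT.apart _ _ (h.apart a b hab hba)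
    rwa [Set.image_image, Set.image_image] at this

/-! ### Joining three drawings at a new root. -/

/-- The placement of a root at `r` and of the three subtrees at its children by `f`. -/
def joinPos (r : ℤ × ℤ) (f : Fin 3 → List (Fin 3) → ℤ × ℤ) : List (Fin 3) → ℤ × ℤ
  | [] => r
  | i :: p => f i p

/-- Old edges stay in their boxes `B i`, since these are closed under segments, and the boxes are
apart. Hence only the three new edges need attention: against the other boxes (`hcross`), each other
(`hmeet`), and their own subtree (`hv`, `he`). -/
theorem IsSeparatedDrawing.join {l : ℕ} (hl : 1 ≤ l) {r : ℤ × ℤ}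
    {f : Fin 3 → List (Fin 3) → ℤ × ℤ} {B : Fin 3 → Set (ℤ × ℤ)}
    (hf : ∀ i, IsSeparatedDrawing l (f i))
    (hB : ∀ i p, p.length < l → f i p ∈ B i)
    (hconv : ∀ i, ∀ a ∈ B i, ∀ b ∈ B i, gridSegment a b ⊆ B i)
    (hap : ∀ i j, i ≠ j → Apart (B i) (B j))
    (hal : ∀ i, r.1 = (f i []).1 ∨ r.2 = (f i []).2)
    (hcross : ∀ i j, i ≠ j → ∀ q ∈ gridSegment r (f i []), q ∉ B j)
    (hmeet : ∀ i j, i ≠ j → ∀ q ∈ gridSegment r (f i []), q ∈ gridSegment r (f j []) → q = r)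
    (hv : ∀ i p, p.length < l → f i p ∈ gridSegment r (f i []) → p = [])
    (he : ∀ i p j, p.length + 1 < l → ∀ q ∈ gridSegment r (f i []),
      q ∈ gridSegment (f i p) (f i (p ++ [j])) → q = f i []) :
    IsSeparatedDrawing (l + 1) (joinPos r f) := by
  -- `r` is an end of the edge to another child, and that edge avoids `B j`; `j + 1` is just some
  -- other index.
  have hr : ∀ j, r ∉ B j := fun j =>
    hcross (j + 1) j (by fin_cases j <;> decide) r (left_mem_gridSegment _ _)
  have hseg : ∀ i p j, p.length + 1 < l → gridSegment (f i p) (f i (p ++ [j])) ⊆ B i :=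
    fun i p j hp => hconv i _ (hB i _ (by omega)) _ (hB i _ (by simpa using hp))
  have hdisj : ∀ i j, i ≠ j → ∀ q, q ∈ B i → q ∉ B j := fun i j hij q hi hj =>
    Set.disjoint_left.1 (hap i j hij).disjoint hi hj
  have hroot : ∀ i p j, p.length + 1 < l → f i [] ∈ gridSegment (f i p) (f i (p ++ [j])) →
      p = [] := fun i p j hp hm => by
    rcases (hf i).vertex_on_edge p j [] hp (by simp; omega) hm with h | h
    · exact h.symm
    · simp at h
  -- A new edge and an old one can meet only in the root of the subtree that the new edge leads to.
  have hmix : ∀ i k p j, p.length + 1 < l → ∀ q, q ∈ gridSegment r (f i []) →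
      q ∈ gridSegment (f k p) (f k (p ++ [j])) → i = k ∧ p = [] ∧ q = f i [] := by
    intro i k p j hp q hq hq'
    have hik : i = k := by
      by_contra hik
      exact hcross i k hik q hq (hseg k p j hp hq')
    subst hik
    have hqe := he i p j hp q hq hq'
    subst hqe
    exact ⟨rfl, hroot i p j hp hq', rfl⟩
  refine ⟨?_, ?_, ?_, ?_, ?_⟩
  · rintro (_ | ⟨i, p⟩) (_ | ⟨j, q⟩) hp hq h
    · rfl
    · exact absurd ((show r = f j q from h) ▸ hB j q (by simpa using hq)) (hr j)
    · exact absurd ((show f i p = r from h) ▸ hB i p (by simpa using hp)) (hr i)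
    · by_cases hij : i = j
      · subst hij
        rw [(hf i).inj p q (by simpa using hp) (by simpa using hq) h]
      · exact absurd ((show f i p = f j q from h) ▸ hB i p (by simpa using hp))
          (hdisj j i (Ne.symm hij) _ (hB j q (by simpa using hq)))
  · rintro (_ | ⟨i, p⟩) j hp
    · exact hal j
    · exact (hf i).aligned p j (by simpa using hp)
  · rintro (_ | ⟨i, p⟩) j (_ | ⟨k, x⟩) hp hx h
    · exact Or.inl rfl
    · have hxl : x.length < l := by simpa using hx
      have hjk : j = k := by
        by_contra hjk
        exact hcross j k hjk _ h (hB k x hxl)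
      subst hjk
      right
      rw [hv j x hxl h]
      rfl
    · exact absurd (hseg i p j (by simpa using hp) h) (hr i)
    · have hxl : x.length < l := by simpa using hx
      have hik : i = k := by
        by_contra hik
        exact hdisj i k hik _ (hseg i p j (by simpa using hp) h) (hB k x hxl)
      subst hik
      rcases (hf i).vertex_on_edge p j x (by simpa using hp) hxl h with h | h
      · exact Or.inl (by rw [h])
      · exact Or.inr (by rw [h]; rfl)
  · rintro (_ | ⟨i, p⟩) j (_ | ⟨i', p'⟩) j' hp hp' hne q hq hq'
    · have hjj : j ≠ j' := by rintro rfl; exact hne rfl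
      exact ⟨[], Or.inl rfl, Or.inl rfl, (hmeet j j' hjj q hq hq').symm⟩
    · obtain ⟨rfl, rfl, rfl⟩ := hmix j i' p' j' (by simpa using hp') q hq hq'
      exact ⟨[j], Or.inr rfl, Or.inl rfl, rfl⟩
    · obtain ⟨rfl, rfl, rfl⟩ := hmix j' i p j (by simpa using hp) q hq' hq
      exact ⟨[j'], Or.inl rfl, Or.inr rfl, rfl⟩
    · have hii : i = i' := by
        by_contra hii
        exact hdisj i i' hii q (hseg i p j (by simpa using hp) hq)
          (hseg i' p' j' (by simpa using hp') hq')
      subst hii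
      obtain ⟨x, h1, h2, h3⟩ := (hf i).edges_meet p j p' j' (by simpa using hp)
        (by simpa using hp') (fun h => hne (by simp [h])) q hq hq'
      refine ⟨i :: x, ?_, ?_, h3⟩
      · rcases h1 with h | h
        · exact Or.inl (by rw [h])
        · exact Or.inr (by rw [h]; rfl)
      · rcases h2 with h | h
        · exact Or.inl (by rw [h])
        · exact Or.inr (by rw [h]; rfl)
  · rintro (_ | ⟨i, a⟩) (_ | ⟨j, b⟩) hab hba
    · exact absurd List.nil_prefix hab
    · exact absurd List.nil_prefix hab
    · exact absurd List.nil_prefix hba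
    · have himg : ∀ k (c : List (Fin 3)), joinPos r f '' {p | k :: c <+: p ∧ p.length < l + 1} ⊆
          f k '' {p | c <+: p ∧ p.length < l} := by
        rintro k c _ ⟨p, ⟨hp, hpl⟩, rfl⟩
        obtain ⟨t, rfl⟩ := hp
        exact ⟨c ++ t, ⟨List.prefix_append c t, by simpa using hpl⟩, rfl⟩
      by_cases hij : i = j
      · subst hij
        refine Apart.mono ((hf i).apart a b ?_ ?_) (himg i a) (himg i b)
        · exact fun h => hab (List.cons_prefix_cons.2 ⟨rfl, h⟩)
        · exact fun h => hba (List.cons_prefix_cons.2 ⟨rfl, h⟩)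
      · refine (hap i j hij).mono ((himg i a).trans ?_) ((himg j b).trans ?_)
        · rintro _ ⟨p, hp, rfl⟩; exact hB i p hp.2
        · rintro _ ⟨p, hp, rfl⟩; exact hB j p hp.2

/-! ### Drawings with a free upward ray, and their dimensions. -/

/-- The complete ternary tree with `l` layers has a separated drawing with `h` rows, with at most
`m` columns on either side of the column of the root, and with no point of the drawing above the
root in its column. -/
def HasDrawing (l : ℕ) (m h : ℤ) : Prop :=
  ∃ (pos : List (Fin 3) → ℤ × ℤ) (u : ℤ), IsSeparatedDrawing l pos ∧ pos [] = (0, 0) ∧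
    (∀ p, p.length < l → -m ≤ (pos p).1 ∧ (pos p).1 ≤ m ∧ u - h < (pos p).2 ∧ (pos p).2 ≤ u) ∧
    (∀ p, p.length < l → (pos p).1 = 0 → 0 ≤ (pos p).2 → p = []) ∧
    (∀ p i, p.length + 1 < l → ∀ q ∈ gridSegment (pos p) (pos (p ++ [i])),
      q.1 = 0 → 0 ≤ q.2 → q = (0, 0))

theorem hasDrawing_one : HasDrawing 1 0 1 := by
  refine ⟨fun _ => (0, 0), 0, ⟨?_, ?_, ?_, ?_, ?_⟩, rfl, ?_, ?_, ?_⟩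
  · intro p q hp hq _
    simp only [Nat.lt_one_iff, List.length_eq_zero_iff] at hp hq
    rw [hp, hq]
  · intros; simp
  · intro p i x hp; omega
  · intro p i p' i' hp; omega
  · intro a b hab hba
    left
    rintro _ ⟨p, ⟨hp, hpl⟩, rfl⟩
    simp only [Nat.lt_one_iff, List.length_eq_zero_iff] at hpl
    subst hpl
    rw [List.prefix_nil] at hp
    subst hp
    exact absurd List.nil_prefix hab
  · intros; simp
  · intro p hp _ _
    simpa using hp
  · intro p i hp; omega

theorem gridSegment_subset_Icc {lo hi a b : ℤ × ℤ} (ha : a ∈ Set.Icc lo hi)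
    (hb : b ∈ Set.Icc lo hi) : gridSegment a b ⊆ Set.Icc lo hi :=
  Set.uIcc_subset_Icc ha hb

-- `k` is the number of empty columns between the root and each side box, `e` the number of empty
-- rows between the root and the lower box. By `hke` the lower box is either below the side boxes or
-- fits between them.
set_option maxHeartbeats 1000000 in
theorem HasDrawing.join {l : ℕ} (hl : 1 ≤ l) {m₁ h₁ m₃ h₃ k e : ℤ} (d₁ : HasDrawing l m₁ h₁)
    (d₃ : HasDrawing l m₃ h₃) (hk : 0 ≤ k) (he : 0 ≤ e) (hke : m₁ ≤ e ∨ m₃ ≤ k) :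
    HasDrawing (l + 1) (max (h₁ + k) m₃) (m₁ + 1 + max m₁ (e + h₃)) := by
  obtain ⟨g, u, hg, hg0, hgb, hgv, hge⟩ := d₁
  obtain ⟨g', u', hg', hg0', hgb', hgv', hge'⟩ := d₃
  have b0 := hgb [] (by simp; omega)
  have b0' := hgb' [] (by simp; omega)
  rw [hg0] at b0
  rw [hg0'] at b0'
  simp only at b0 b0'
  have Tw := isGridEmbedding_rotate_right (-(u + 1 + k))
  have Te := isGridEmbedding_rotate_left (u + 1 + k)
  have Ts := isGridEmbedding_translate 0 (-(u' + 1 + e))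
  -- The shifts send the top row `u` of the side drawing to the columns `-(1 + k)` and `1 + k`, and
  -- the top row `u'` of the lower one to the row `-(1 + e)`.
  set f : Fin 3 → List (Fin 3) → ℤ × ℤ :=
    ![fun p => ((g p).2 + -(u + 1 + k), (g p).1), fun p => (u + 1 + k - (g p).2, (g p).1),
      fun p => ((g' p).1 + 0, (g' p).2 + -(u' + 1 + e))] with hfdef
  have hB : ∀ i p, p.length < l → f i p ∈ (![Set.Icc (-(h₁ + k), -m₁) (-(1 + k), m₁),
      Set.Icc (1 + k, -m₁) (h₁ + k, m₁), Set.Icc (-m₃, -(h₃ + e)) (m₃, -(1 + e))] i :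
        Set (ℤ × ℤ)) := by
    intro i p hp
    have := hgb p hp
    have := hgb' p hp
    fin_cases i <;> simp [hfdef, Prod.le_def] <;> omega
  have hf0 : f 0 [] = (-(u + 1 + k), 0) := by simp [hfdef, hg0]
  have hf1 : f 1 [] = (u + 1 + k, 0) := by simp [hfdef, hg0]
  have hf2 : f 2 [] = (0, -(u' + 1 + e)) := by simp [hfdef, hg0']
  -- The top row is now `m₁`: after the turn, the half-width of the side drawings extends above the
  -- root.
  refine ⟨joinPos (0, 0) f, m₁, IsSeparatedDrawing.join hl (f := f) ?_ hB ?_ ?_ ?_ ?_ ?_ ?_ ?_,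
    rfl, ?_, ?_, ?_⟩
  · intro i
    fin_cases i
    · exact hg.comp Tw
    · exact hg.comp Te
    · exact hg'.comp Ts
  · intro i a ha b hb
    fin_cases i <;> exact gridSegment_subset_Icc ha hb
  · have h01 : Apart (Set.Icc (-(h₁ + k), -m₁) (-(1 + k), m₁))
        (Set.Icc (1 + k, -m₁) (h₁ + k, m₁)) := by
      left
      rintro p ⟨-, hp, -⟩ q ⟨⟨hq, -⟩, -⟩
      simp only at hp hq
      omega
    have h02 : Apart (Set.Icc (-(h₁ + k), -m₁) (-(1 + k), m₁))
        (Set.Icc (-m₃, -(h₃ + e)) (m₃, -(1 + e))) := by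
      rcases hke with hke | hke
      · right; right; right
        rintro p ⟨⟨-, hp⟩, -⟩ q ⟨-, -, hq⟩
        simp only at hp hq
        omega
      · left
        rintro p ⟨-, hp, -⟩ q ⟨⟨hq, -⟩, -⟩
        simp only at hp hq
        omega
    have h12 : Apart (Set.Icc (1 + k, -m₁) (h₁ + k, m₁))
        (Set.Icc (-m₃, -(h₃ + e)) (m₃, -(1 + e))) := by
      rcases hke with hke | hke
      · right; right; right
        rintro p ⟨⟨-, hp⟩, -⟩ q ⟨-, -, hq⟩
        simp only at hp hq
        omega
      · right; left
        rintro p ⟨⟨hp, -⟩, -⟩ q ⟨-, hq, -⟩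
        simp only at hp hq
        omega
    intro i j hij
    fin_cases i <;> fin_cases j
    · exact absurd rfl hij
    · exact h01
    · exact h02
    · exact h01.symm
    · exact absurd rfl hij
    · exact h12
    · exact h02.symm
    · exact h12.symm
    · exact absurd rfl hij
  · intro i
    fin_cases i
    · right; exact hf0 ▸ rfl
    · right; exact hf1 ▸ rfl
    · left; exact hf2 ▸ rfl
  · intro i j hij q hq hqB
    fin_cases i <;> fin_cases j <;>
      first
        | exact absurd rfl hij
        | (simp [hf0, hf1, hf2, mem_gridSegment, Prod.le_def] at hq hqB
           omega)
  · intro i j hij q hq hq'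
    fin_cases i <;> fin_cases j <;>
      first
        | exact absurd rfl hij
        | (simp [hf0, hf1, hf2, mem_gridSegment] at hq hq'
           ext <;> simp <;> omega)
  -- Pulled back to the child's own drawing, the new edge lies on the free upward ray of the child.
  · intro i p hp hq
    fin_cases i
    · refine hgv p hp ?_ ?_ <;> simp [hfdef, mem_gridSegment, hg0] at hq <;> omega
    · refine hgv p hp ?_ ?_ <;> simp [hfdef, mem_gridSegment, hg0] at hq <;> omega
    · refine hgv' p hp ?_ ?_ <;> simp [hfdef, mem_gridSegment, hg0'] at hq <;> omega
  · intro i p j hp q hq hq'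
    fin_cases i
    · obtain ⟨q', rfl, hm⟩ := Tw.segment _ _ _ hq'
      have := hge p j hp q' hm
      simp [hfdef, mem_gridSegment, hg0] at hq ⊢
      simp [Prod.ext_iff] at this
      omega
    · obtain ⟨q', rfl, hm⟩ := Te.segment _ _ _ hq'
      have := hge p j hp q' hm
      simp [hfdef, mem_gridSegment, hg0] at hq ⊢
      simp [Prod.ext_iff] at this
      omega
    · obtain ⟨q', rfl, hm⟩ := Ts.segment _ _ _ hq'
      have := hge' p j hp q' hm
      simp [hfdef, mem_gridSegment, hg0'] at hq ⊢
      simp [Prod.ext_iff] at this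
      omega
  · rintro (_ | ⟨i, p⟩) hp
    · simp [joinPos]; omega
    · have := hB i p (by simpa using hp)
      simp only [joinPos]
      fin_cases i <;> simp [Prod.le_def] at this ⊢ <;> omega
  -- The side boxes miss the column of the root and the lower box lies strictly below the root, so
  -- the ray stays free.
  · rintro (_ | ⟨i, p⟩) hp hx hy
    · rfl
    · have := hB i p (by simpa using hp)
      simp only [joinPos] at hx hy
      fin_cases i <;> simp [Prod.le_def] at this hx hy <;> omega
  · rintro (_ | ⟨i, p⟩) j hp q hq hx hy
    · simp only [joinPos, List.nil_append] at hq
      fin_cases j <;> simp [hf0, hf1, hf2, mem_gridSegment] at hq <;> ext <;> simp <;> omega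
    · have h1 := hB i p (by simp at hp; omega)
      have h2 := hB i (p ++ [j]) (by simpa using hp)
      simp only [joinPos, List.cons_append] at hq
      fin_cases i <;> have := gridSegment_subset_Icc h1 h2 hq <;>
        simp [Prod.le_def] at this <;> omega

/-! ### From the recursive drawings to drawings in the `w × h` grid. -/

theorem HasDrawing.exists_drawing {l : ℕ} {m h : ℤ} (d : HasDrawing l m h) :
    ∃ Γ : StraightLineOrthogonalDrawing (completeTernaryTree l) (2 * m + 1).toNat h.toNat,
      SubtreeSeparated Γ := by
  obtain ⟨g, u, hg, -, hgb, -, -⟩ := d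
  have hg' := hg.comp (isGridEmbedding_translate m (h - 1 - u))
  have hgb' : ∀ p, p.length < l → 0 ≤ (g p).1 + m ∧ (g p).1 + m < 2 * m + 1 ∧
      0 ≤ (g p).2 + (h - 1 - u) ∧ (g p).2 + (h - 1 - u) < h := fun p hp => by
    have := hgb p hp
    omega
  generalize hpos : (fun p => ((g p).1 + m, (g p).2 + (h - 1 - u))) = pos at hg'
  have hpos' : ∀ p, pos p = ((g p).1 + m, (g p).2 + (h - 1 - u)) := fun p => by rw [← hpos]
  have hlen : ∀ {p q : TernaryNode l} {i : Fin 3}, q.1 = p.1 ++ [i] → p.1.length + 1 < l := by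
    intro p q i h
    have := q.2
    rw [h] at this
    simpa using this
  -- Adjacency is symmetric, while `IsSeparatedDrawing` speaks of edges from parent to child, so
  -- every edge is first oriented.
  have hedge : ∀ u v : TernaryNode l, (completeTernaryTree l).Adj u v →
      ∃ (p q : TernaryNode l) (i : Fin 3), s(u, v) = s(p, q) ∧ q.1 = p.1 ++ [i] ∧
        gridSegment (pos u.1) (pos v.1) = gridSegment (pos p.1) (pos (p.1 ++ [i])) := by
    rintro u v (⟨i, hi⟩ | ⟨i, hi⟩)
    · exact ⟨u, v, i, rfl, hi, by rw [hi]⟩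
    · exact ⟨v, u, i, Sym2.eq_swap, hi, by rw [hi, gridSegment_comm]⟩
  refine ⟨⟨fun v => pos v.1, ?_, ?_, ?_, ?_, ?_⟩, ?_⟩
  · intro p q h
    exact Subtype.ext (hg'.inj _ _ p.2 q.2 h)
  · intro v
    have := hgb' v.1 v.2
    rw [hpos']
    simp only
    omega
  · rintro u v (⟨i, hi⟩ | ⟨i, hi⟩)
    · rw [hi]
      exact hg'.aligned _ i (hlen hi)
    · rw [hi]
      have := hg'.aligned _ i (hlen hi)
      omega
  · intro u v huv x hx
    obtain ⟨p, q, i, hs, hq, hseg⟩ := hedge u v huv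
    rw [hseg] at hx
    have hxs : x ∈ s(p, q) := by
      rw [Sym2.mem_iff, Subtype.ext_iff, Subtype.ext_iff, hq]
      exact hg'.vertex_on_edge _ i _ (hlen hq) x.2 hx
    rwa [← hs, Sym2.mem_iff] at hxs
  · rintro u v u' v' huv huv' hne r ⟨hr, hr'⟩
    obtain ⟨p, q, i, hs, hq, hseg⟩ := hedge u v huv
    obtain ⟨p', q', i', hs', hq', hseg'⟩ := hedge u' v' huv'
    rw [hseg] at hr
    rw [hseg'] at hr'
    obtain ⟨x, h1, h2, h3⟩ := hg'.edges_meet _ i _ i' (hlen hq) (hlen hq') (by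
      intro h
      rw [hs, hs'] at hne
      have hpp : p = p' := Subtype.ext (List.append_inj_left' h rfl)
      have hqq : q = q' := Subtype.ext (by rw [hq, hq', h])
      exact hne (by rw [hpp, hqq])) r hr hr'
    have hxl : x.length < l := by
      rcases h1 with rfl | rfl
      · exact p.2
      · exact hq ▸ q.2
    refine ⟨⟨x, hxl⟩, ?_, ?_, h3⟩
    · rw [hs, Sym2.mem_iff, Subtype.ext_iff, Subtype.ext_iff, hq]
      exact h1
    · rw [hs', Sym2.mem_iff, Subtype.ext_iff, Subtype.ext_iff, hq']
      exact h2
  · intro a b hab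
    rw [Set.disjoint_left] at hab
    have himg : ∀ c : TernaryNode l, (fun v : TernaryNode l => pos v.1) '' c.subtree ⊆
        pos '' {p | c.1 <+: p ∧ p.length < l} := by
      rintro c _ ⟨v, hv, rfl⟩
      exact ⟨v.1, ⟨hv, v.2⟩, rfl⟩
    refine Apart.disjoint_boundingRectangle (Apart.mono (hg'.apart a.1 b.1 ?_ ?_) (himg a) (himg b))
    · exact fun h => hab (a := b) h List.prefix_rfl
    · exact fun h => hab (a := a) List.prefix_rfl h

/-! ### Homogeneous recursion rules for the dimensions. -/

/-- The complete ternary tree with `l` layers has a drawing in the sense of `HasDrawing` whose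
dimensions, enlarged by one, are at most `x` and `y`. -/
def DrawableWithin (l : ℕ) (x y : ℝ) : Prop :=
  ∃ m h : ℤ, HasDrawing l m h ∧ (m : ℝ) + 1 ≤ x ∧ (h : ℝ) + 1 ≤ y

theorem HasDrawing.nonneg {l : ℕ} (hl : 1 ≤ l) {m h : ℤ} (d : HasDrawing l m h) :
    0 ≤ m ∧ 0 ≤ h := by
  obtain ⟨g, u, -, -, hgb, -, -⟩ := d
  have := hgb [] (by simp; omega)
  omega

theorem drawableWithin_one {x y : ℝ} (hx : 1 ≤ x) (hy : 2 ≤ y) : DrawableWithin 1 x y :=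
  ⟨0, 1, hasDrawing_one, by simpa using hx, by norm_num; exact hy⟩

/-- The subtree below the root is drawn below the other two. -/
theorem DrawableWithin.join_below {l : ℕ} (hl : 1 ≤ l) {x₁ y₁ x₃ y₃ x y : ℝ}
    (d₁ : DrawableWithin l x₁ y₁) (d₃ : DrawableWithin l x₃ y₃) (hy₁ : y₁ ≤ x) (hx₃ : x₃ ≤ x)
    (hy : 2 * x₁ + y₃ ≤ y) : DrawableWithin (l + 1) x y := by
  obtain ⟨m, h, d, h1, h2⟩ := d₁
  obtain ⟨m', h', d', h1', h2'⟩ := d₃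
  have hm := (d.nonneg hl).1
  have hh' := (d'.nonneg hl).2
  -- Gaps `k = 0` and `e = m`: the lower box starts just under the side boxes.
  refine ⟨_, _, d.join hl d' le_rfl hm (Or.inl le_rfl), ?_, ?_⟩
  · rw [add_zero, Int.cast_max]
    have : max (h : ℝ) m' ≤ x - 1 := max_le (by linarith) (by linarith)
    linarith
  · rw [max_eq_right (by omega)]
    push_cast
    linarith

/-- The subtree below the root is drawn between the other two. -/
theorem DrawableWithin.join_between {l : ℕ} (hl : 1 ≤ l) {x₁ y₁ x₃ y₃ x y : ℝ}
    (d₁ : DrawableWithin l x₁ y₁) (d₃ : DrawableWithin l x₃ y₃) (hx : x₃ + y₁ ≤ x)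
    (hxy : x₁ ≤ y₃) (hy : x₁ + y₃ ≤ y) : DrawableWithin (l + 1) x y := by
  obtain ⟨m, h, d, h1, h2⟩ := d₁
  obtain ⟨m', h', d', h1', h2'⟩ := d₃
  have hm' := (d'.nonneg hl).1
  have hh := (d.nonneg hl).2
  -- Gaps `k = m'` and `e = 0`: the side boxes move out just far enough for the lower box.
  refine ⟨_, _, d.join hl d' hm' le_rfl (Or.inr le_rfl), ?_, ?_⟩
  · rw [max_eq_left (by omega)]
    push_cast
    linarith
  · rw [zero_add]
    push_cast
    have : max (m : ℝ) h' ≤ y₃ - 1 := max_le (by linarith) (by linarith)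
    linarith

/-! ### Regions cut out by half planes, and polygonal lines. -/

/-- The points `(x, y)` with `c ≤ a * x + b * y` for all triples `(a, b, c)` in the list `H`. -/
def region (H : List (ℕ × ℕ × ℕ)) : Set (ℝ × ℝ) :=
  {p | ∀ t ∈ H, (t.2.2 : ℝ) ≤ t.1 * p.1 + t.2.1 * p.2}

theorem convex_region (H : List (ℕ × ℕ × ℕ)) : Convex ℝ (region H) := by
  intro p hp q hq a b ha hb hab t ht
  have h1 := mul_le_mul_of_nonneg_left (hp t ht) ha
  have h2 := mul_le_mul_of_nonneg_left (hq t ht) hb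
  have h3 : (t.2.2 : ℝ) = a * t.2.2 + b * t.2.2 := by rw [← add_mul, hab, one_mul]
  simp only [Prod.fst_add, Prod.snd_add, Prod.smul_fst, Prod.smul_snd, smul_eq_mul]
  linarith

def inRegion (H : List (ℕ × ℕ × ℕ)) (x y : ℕ) : Bool :=
  H.all fun t => Nat.ble t.2.2 (Nat.add (Nat.mul t.1 x) (Nat.mul t.2.1 y))

theorem mem_region_of_inRegion {H : List (ℕ × ℕ × ℕ)} {x y : ℕ} (h : inRegion H x y = true) :
    ((x : ℝ), (y : ℝ)) ∈ region H := by
  intro t ht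
  have := Nat.le_of_ble_eq_true (List.all_eq_true.1 h t ht)
  have h2 : t.2.2 ≤ t.1 * x + t.2.1 * y := this
  simp only
  exact_mod_cast h2

/-- The half planes above the lines through consecutive points `(m, h)` of a list of quadruples
`(m, h, _, _)`. -/
def chords : List (ℕ × ℕ × ℕ × ℕ) → List (ℕ × ℕ × ℕ)
  | u :: v :: r =>
    (u.2.1 - v.2.1, v.1 - u.1, (u.2.1 - v.2.1) * u.1 + (v.1 - u.1) * u.2.1) :: chords (v :: r)
  | _ => []

/-- In the list of quadruples `(m, h, _, _)`, the first entries increase and the second ones do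
not. -/
def isStaircase : List (ℕ × ℕ × ℕ × ℕ) → Bool
  | u :: v :: r => Nat.blt u.1 v.1 && Nat.ble v.2.1 u.2.1 && isStaircase (v :: r)
  | _ => true

/-- A point above a polygonal line dominates a point on it, unless it is to its right. -/
theorem exists_chord_le (r : List (ℕ × ℕ × ℕ × ℕ)) : ∀ u, isStaircase (u :: r) = true →
    ∀ p ∈ region (chords (u :: r)), (u.1 : ℝ) ≤ p.1 →
      (∃ v ∈ u :: r, ∃ w ∈ u :: r, ∃ a b : ℝ, 0 ≤ a ∧ 0 ≤ b ∧ a + b = 1 ∧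
        a * v.1 + b * w.1 ≤ p.1 ∧ a * v.2.1 + b * w.2.1 ≤ p.2) ∨
      (((u :: r).getLast (by simp)).1 : ℝ) ≤ p.1 := by
  induction r with
  | nil =>
    intro u _ p _ hp
    exact Or.inr (by simpa using hp)
  | cons v r ih =>
    intro u hs p hp hup
    simp only [isStaircase, Bool.and_eq_true] at hs
    obtain ⟨⟨h1, h2⟩, h3⟩ := hs
    have h1 : u.1 < v.1 := Nat.le_of_ble_eq_true h1
    have h2 : v.2.1 ≤ u.2.1 := Nat.le_of_ble_eq_true h2
    rcases le_total (v.1 : ℝ) p.1 with hv | hv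
    · rcases ih v h3 p (fun t ht => hp t (by simp [chords, ht])) hv with
        ⟨x, hx, w, hw, h⟩ | h
      · exact Or.inl ⟨x, List.mem_cons_of_mem _ hx, w, List.mem_cons_of_mem _ hw, h⟩
      · exact Or.inr (by simpa using h)
    · left
      have h1' : (0 : ℝ) < v.1 - u.1 := sub_pos.2 (by exact_mod_cast h1)
      have hc := hp _ (List.mem_cons_self (l := chords (v :: r)))
      simp only at hc
      -- The staircase condition makes the truncated differences in `chords` genuine ones.
      push_cast [Nat.cast_sub h1.le, Nat.cast_sub h2] at hc
      have hb : (v.1 - u.1 : ℝ) * ((p.1 - u.1) / (v.1 - u.1)) = p.1 - u.1 :=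
        mul_div_cancel₀ _ h1'.ne'
      -- With these weights the combination of `u` and `v` has first coordinate exactly `p.1`.
      refine ⟨u, by simp, v, by simp, 1 - (p.1 - u.1) / (v.1 - u.1),
        (p.1 - u.1) / (v.1 - u.1), ?_, ?_, by ring, ?_, ?_⟩
      · rw [sub_nonneg, div_le_one h1']
        linarith
      · exact div_nonneg (by linarith) h1'.le
      · linarith
      · refine le_of_mul_le_mul_left ?_ h1'
        generalize (p.1 - u.1) / (v.1 - u.1 : ℝ) = b at hb
        have : (v.1 - u.1 : ℝ) * ((1 - b) * u.2.1 + b * v.2.1) =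
            (v.1 - u.1) * u.2.1 - ((v.1 - u.1 : ℝ) * b) * (u.2.1 - v.2.1) := by ring
        rw [this, hb]
        linarith

/-! ### The growth factor and certificates for single vertices. -/

/-- A rational number a little less than `3 ^ 0.516`. -/
noncomputable def growth : ℝ := 44069 / 25000

/-- As `1.032 * 125 = 129`, comparing 125th powers leaves an inequality between rationals. -/
theorem growth_sq_le : growth ^ 2 ≤ 3 ^ (1.032 : ℝ) := by
  have h : (growth ^ 2) ^ 125 ≤ (3 ^ (1.032 : ℝ)) ^ 125 := by
    rw [← Real.rpow_natCast (3 ^ (1.032 : ℝ)), ← Real.rpow_mul (by norm_num)]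
    have : (1.032 : ℝ) * ((125 : ℕ) : ℝ) = ((129 : ℕ) : ℝ) := by norm_num
    rw [this, Real.rpow_natCast, growth]
    norm_num
  exact le_of_pow_le_pow_left₀ (by norm_num) (by positivity) h

/-- The quadruple `(m, h, x₁, y₃)` certifies that `growth • (m, h)` is obtained by
`DrawableWithin.join_below` from points of the region. -/
def certifiedBelow (H : List (ℕ × ℕ × ℕ)) (r : ℕ × ℕ × ℕ × ℕ) : Bool :=
  inRegion H r.2.2.1 (44069 * r.1 / 25000) && inRegion H (44069 * r.1 / 25000) r.2.2.2 &&
    Nat.ble (25000 * (2 * r.2.2.1 + r.2.2.2)) (44069 * r.2.1)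

/-- The quadruple `(m, h, x₁, y₁)` certifies that `growth • (m, h)` is obtained by
`DrawableWithin.join_between` from points of the region. -/
def certifiedBetween (H : List (ℕ × ℕ × ℕ)) (r : ℕ × ℕ × ℕ × ℕ) : Bool :=
  inRegion H r.2.2.1 r.2.2.2 &&
    inRegion H (44069 * r.1 / 25000 - r.2.2.2) (44069 * r.2.1 / 25000 - r.2.2.1) &&
      (Nat.ble (2 * r.2.2.1) (44069 * r.2.1 / 25000) && Nat.ble r.2.2.2 (44069 * r.1 / 25000))

theorem cast_le_growth_mul (n : ℕ) : ((44069 * n / 25000 : ℕ) : ℝ) ≤ growth * n := by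
  refine Nat.cast_div_le.trans (le_of_eq ?_)
  rw [growth]
  push_cast
  ring

/-- The choice `y₁ = x₃ = ⌊growth * m⌋` exhausts the allowed width up to rounding, so only `x₁` and
`y₃` are stored. -/
theorem certifiedBelow.spec {H : List (ℕ × ℕ × ℕ)} {r : ℕ × ℕ × ℕ × ℕ}
    (h : certifiedBelow H r = true) : ∃ p ∈ region H, ∃ q ∈ region H,
      p.2 ≤ growth * r.1 ∧ q.1 ≤ growth * r.1 ∧ 2 * p.1 + q.2 ≤ growth * r.2.1 := by
  simp only [certifiedBelow, Bool.and_eq_true] at h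
  obtain ⟨⟨h1, h2⟩, h3⟩ := h
  refine ⟨_, mem_region_of_inRegion h1, _, mem_region_of_inRegion h2, cast_le_growth_mul _,
    cast_le_growth_mul _, ?_⟩
  have : ((25000 * (2 * r.2.2.1 + r.2.2.2) : ℕ) : ℝ) ≤ (44069 * r.2.1 : ℕ) :=
    Nat.cast_le.2 (Nat.le_of_ble_eq_true h3)
  push_cast at this
  rw [growth]
  simp only
  linarith

/-- Here `x₃` and `y₃` are what `y₁` and `x₁` leave of `⌊growth * m⌋` and `⌊growth * h⌋`; the check
`2x₁ ≤ ⌊growth * h⌋` then says `x₁ ≤ y₃`. -/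
theorem certifiedBetween.spec {H : List (ℕ × ℕ × ℕ)} {r : ℕ × ℕ × ℕ × ℕ}
    (h : certifiedBetween H r = true) : ∃ p ∈ region H, ∃ q ∈ region H,
      q.1 + p.2 ≤ growth * r.1 ∧ p.1 ≤ q.2 ∧ p.1 + q.2 ≤ growth * r.2.1 := by
  simp only [certifiedBetween, Bool.and_eq_true] at h
  obtain ⟨⟨h1, h2⟩, h3, h4⟩ := h
  have h3 := Nat.le_of_ble_eq_true h3
  have h4 := Nat.le_of_ble_eq_true h4
  have e1 := cast_le_growth_mul r.1
  have e2 := cast_le_growth_mul r.2.1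
  refine ⟨_, mem_region_of_inRegion h1, _, mem_region_of_inRegion h2, ?_, ?_, ?_⟩
  · simp only
    rw [Nat.cast_sub h4]
    linarith
  · simp only
    exact_mod_cast (by omega : r.2.2.1 ≤ 44069 * r.2.1 / 25000 - r.2.2.1)
  · simp only
    rw [Nat.cast_sub (by omega)]
    linarith

/-- The trees with `l` layers have drawings within `c • p` for all points `p` of the region. -/
def DrawableOn (H : List (ℕ × ℕ × ℕ)) (l : ℕ) (c : ℝ) : Prop :=
  ∀ p ∈ region H, DrawableWithin l (c * p.1) (c * p.2)

/-- The inequalities of the rule are linear and the region is convex, so the witnesses of two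
vertices can be averaged with the same weights. -/
theorem DrawableOn.below {H : List (ℕ × ℕ × ℕ)} {l : ℕ} (hl : 1 ≤ l) {c : ℝ} (hc : 0 ≤ c)
    (hd : DrawableOn H l c) {v w : ℕ × ℕ × ℕ × ℕ} (hv : certifiedBelow H v = true)
    (hw : certifiedBelow H w = true) {a b : ℝ} (ha : 0 ≤ a) (hb : 0 ≤ b) (hab : a + b = 1)
    {x y : ℝ} (hx : a * v.1 + b * w.1 ≤ x) (hy : a * v.2.1 + b * w.2.1 ≤ y) :
    DrawableWithin (l + 1) (c * growth * x) (c * growth * y) := by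
  obtain ⟨p, hp, q, hq, h1, h2, h3⟩ := certifiedBelow.spec hv
  obtain ⟨p', hp', q', hq', h1', h2', h3'⟩ := certifiedBelow.spec hw
  have hg : 0 ≤ growth := by unfold growth; norm_num
  have hx' := mul_le_mul_of_nonneg_left hx hg
  have hy' := mul_le_mul_of_nonneg_left hy hg
  refine (hd _ (convex_region H hp hp' ha hb hab)).join_below hl
    (hd _ (convex_region H hq hq' ha hb hab)) ?_ ?_ ?_ <;>
    simp only [Prod.fst_add, Prod.snd_add, Prod.smul_fst, Prod.smul_snd, smul_eq_mul]
  · rw [mul_assoc]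
    refine mul_le_mul_of_nonneg_left ?_ hc
    linarith [mul_le_mul_of_nonneg_left h1 ha, mul_le_mul_of_nonneg_left h1' hb]
  · rw [mul_assoc]
    refine mul_le_mul_of_nonneg_left ?_ hc
    linarith [mul_le_mul_of_nonneg_left h2 ha, mul_le_mul_of_nonneg_left h2' hb]
  · have : a * (2 * p.1 + q.2) + b * (2 * p'.1 + q'.2) ≤ growth * y := by
      linarith [mul_le_mul_of_nonneg_left h3 ha, mul_le_mul_of_nonneg_left h3' hb]
    linarith [mul_le_mul_of_nonneg_left this hc]

theorem DrawableOn.between {H : List (ℕ × ℕ × ℕ)} {l : ℕ} (hl : 1 ≤ l) {c : ℝ} (hc : 0 ≤ c)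
    (hd : DrawableOn H l c) {v w : ℕ × ℕ × ℕ × ℕ} (hv : certifiedBetween H v = true)
    (hw : certifiedBetween H w = true) {a b : ℝ} (ha : 0 ≤ a) (hb : 0 ≤ b) (hab : a + b = 1)
    {x y : ℝ} (hx : a * v.1 + b * w.1 ≤ x) (hy : a * v.2.1 + b * w.2.1 ≤ y) :
    DrawableWithin (l + 1) (c * growth * x) (c * growth * y) := by
  obtain ⟨p, hp, q, hq, h1, h2, h3⟩ := certifiedBetween.spec hv
  obtain ⟨p', hp', q', hq', h1', h2', h3'⟩ := certifiedBetween.spec hw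
  have hg : 0 ≤ growth := by unfold growth; norm_num
  have hx' := mul_le_mul_of_nonneg_left hx hg
  have hy' := mul_le_mul_of_nonneg_left hy hg
  refine (hd _ (convex_region H hp hp' ha hb hab)).join_between hl
    (hd _ (convex_region H hq hq' ha hb hab)) ?_ ?_ ?_ <;>
    simp only [Prod.fst_add, Prod.snd_add, Prod.smul_fst, Prod.smul_snd, smul_eq_mul]
  · have : a * (q.1 + p.2) + b * (q'.1 + p'.2) ≤ growth * x := by
      linarith [mul_le_mul_of_nonneg_left h1 ha, mul_le_mul_of_nonneg_left h1' hb]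
    linarith [mul_le_mul_of_nonneg_left this hc]
  · refine mul_le_mul_of_nonneg_left ?_ hc
    linarith [mul_le_mul_of_nonneg_left h2 ha, mul_le_mul_of_nonneg_left h2' hb]
  · have : a * (p.1 + q.2) + b * (p'.1 + q'.2) ≤ growth * y := by
      linarith [mul_le_mul_of_nonneg_left h3 ha, mul_le_mul_of_nonneg_left h3' hb]
    linarith [mul_le_mul_of_nonneg_left this hc]

/-! ### The numerical data and their verification. -/

/-- Vertices `(m, h)` of the region of attainable dimensions, with the witnesses that
`certifiedBelow` wants.  The vertices approximate a curve that is invariant under the recursion. -/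
def verticesBelow : List (ℕ × ℕ × ℕ × ℕ) :=
  [(1012220, 271616378621, 196049713614, 86585109165),
   (1042746, 255825663859, 184650524420, 81554605379),
   (1074175, 240949199016, 173910410442, 76817148038),
   (1106556, 226938661395, 163795461539, 72355330681),
   (1139798, 213721219780, 154246103215, 68168455599),
   (1174169, 201296065456, 145272240978, 64210714532),
   (1209571, 189592290669, 136822903018, 60483004601),
   (1246031, 178567618254, 128863293713, 56972628648),
   (1283540, 168177622420, 121358571322, 53671407278),
   (1322257, 158401552269, 114301424312, 50557005805),
   (1362140, 149193514671, 107653974327, 47623844160),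
   (1403214, 140519544104, 101391699224, 44861620924),
   (1445500, 132347520799, 95490629208, 42261935477),
   (1489068, 124651288460, 89932951039, 39813626839),
   (1533960, 117403472905, 84699469980, 37507322481),
   (1580231, 110578913735, 79772680465, 35333802972),
   (1627882, 104150008522, 75130852440, 33287330184),
   (1676957, 98094143529, 70757884670, 31360685927),
   (1727530, 92391419474, 66640366552, 29545745279),
   (1779663, 87021896155, 62764064025, 27835273936),
   (1833359, 81963946132, 59112454495, 26224547592),
   (1888659, 77199361057, 55672267800, 24708026971),
   (1945635, 72712040019, 52432269509, 23279809486),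
   (2004356, 68486433995, 49381505771, 21934371362),
   (2064858, 64506639007, 46508219984, 20666988546),
   (2127182, 60758021724, 43801827824, 19473445393),
   (2191387, 57227233005, 41252537264, 18349482243),
   (2257549, 53902098087, 38851879503, 17290789065),
   (2325732, 50770664385, 36591241640, 16293377364),
   (2395981, 47821302702, 34462094034, 15353915473),
   (2468352, 45043256015, 32456376506, 14469194990),
   (2542925, 42426861641, 30567327609, 13636289967),
   (2619777, 39962844225, 28788431436, 12851614219),
   (2698969, 37642179791, 27113124069, 12112445813),
   (2780562, 35456360858, 25535130186, 11416249285),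
   (2864636, 33397633231, 24048897900, 10760513509),
   (2951278, 31458725417, 22649237166, 10142812684),
   (3040570, 29632663219, 21331094240, 9560909524),
   (3132582, 27912772128, 20089653273, 9012784127),
   (3227397, 26292844629, 18920351789, 8496489950),
   (3325109, 24767138148, 17819161225, 8010197014),
   (3425819, 23330235726, 16782210765, 7552102987),
   (3529623, 21976966464, 15805524319, 7120508296),
   (3636601, 20702354177, 14885631336, 6713950938),
   (3746856, 19501849951, 14019245599, 6330993734),
   (3860501, 18371189352, 13203316074, 5970225046),
   (3977648, 17306313818, 12434908584, 5630323817),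
   (4098394, 16303343314, 11711206834, 5310115450),
   (4222853, 15358672892, 11029609217, 5008464070),
   (4351150, 14468931459, 10387678242, 4724267464), (4483411, 13630936113, 9783134588, 4456500104),
   (4619758, 12841657570, 9213778730, 4204213619), (4760318, 12098250417, 8677547471, 3966517258),
   (4905229, 11398052280, 8172522236, 3742565223), (5054638, 10738562746, 7696898024, 3531552849),
   (5208693, 10117415206, 7248958283, 3332739088), (5367543, 9532373792, 6827077710, 3145439283),
   (5531340, 8981328913, 6429745914, 2968961947), (5700250, 8462308535, 6055539824, 2802666632),
   (5874457, 7973471143, 5703099449, 2646037703), (6054135, 7513053677, 5371156384, 2498493533),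
   (6239451, 7079384672, 5058532709, 2359458234), (6430595, 6670909582, 4764106079, 2228430449),
   (6627777, 6286175540, 4486821149, 2104956195), (6831198, 5923797733, 4225682486, 1988591134),
   (7041062, 5582467596, 3979741599, 1878921061), (7257589, 5260961606, 3748115022, 1775562020),
   (7481012, 4958129111, 3529976886, 1678136202), (7711566, 4672881767, 3324543311, 1586291476),
   (7949495, 4404194308, 3131073257, 1499705283), (8195054, 4151102975, 2948869346, 1418072902),
   (8448513, 3912701234, 2777276153, 1341107616), (8710156, 3688137113, 2615673901, 1268546658),
   (8980278, 3476607360, 2463479659, 1200142226), (9259200, 3277358979, 2320134995, 1135681092),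
   (9547268, 3089686288, 2185113951, 1074974288), (9844767, 2912899135, 2057958399, 1017721232),
   (10152056, 2746368146, 1938209439, 963730466), (10469680, 2589541375, 1825380822, 912988671),
   (10797911, 2441821700, 1719115293, 865184417), (11137081, 2302662592, 1619043791, 820078078),
   (11487643, 2171573759, 1524812403, 777514353), (11850084, 2048093616, 1436088291, 737345122),
   (12224807, 1931768587, 1352539585, 699435205), (12612336, 1822188613, 1273849510, 663695106),
   (13013173, 1718959889, 1199745369, 629976792), (13427815, 1621707782, 1129968210, 598136751),
   (13856812, 1530084148, 1064265049, 568068934), (14300763, 1443763015, 1002399426, 539670381),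
   (14760270, 1362434825, 944145895, 512847231), (15236040, 1285814374, 889286176, 487533405),
   (15728791, 1213629800, 837624309, 463641238), (16239401, 1145633289, 788960533, 441128592),
   (16769134, 1081610660, 743081657, 420055154), (17318222, 1021288309, 699885231, 400138002),
   (17887629, 964456300, 659219417, 381310995), (18478394, 910916839, 620945632, 363502677),
   (19091389, 860472026, 584919023, 346653613), (19727561, 812937849, 551004587, 330709771),
   (20388081, 768148211, 519078644, 315625953), (21074179, 725945580, 489020102, 301366516),
   (21787052, 686177702, 460719821, 287881428), (22529010, 648731455, 434042022, 275239894),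
   (23300609, 613443885, 408929166, 263275988), (24103217, 580186091, 385302600, 251916763),
   (24938676, 548845884, 363083387, 241122293), (25808386, 519305108, 342181815, 230863727),
   (26715131, 491477651, 322540940, 221111348), (27661131, 465265800, 304070331, 211857203),
   (28648427, 440571805, 286679356, 203116801), (29681032, 417330032, 270293058, 194928612),
   (30759804, 395429381, 254888659, 187140180), (31887774, 374795432, 240414027, 179724543),
   (33067592, 355350867, 226807999, 172667805), (34302235, 337024877, 214015033, 165956321),
   (35595122, 319753090, 201986515, 159573788), (36951518, 303487826, 190660684, 153558367),
   (38375532, 288169568, 180001937, 147879201), (39869592, 273728634, 169993486, 142445617),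
   (41437801, 260111684, 160596629, 137240929), (43084193, 247266819, 151771876, 132252698),
   (44813388, 235147508, 143483696, 127470016), (46630444, 223710763, 135698485, 122884322),
   (48545200, 212935637, 128367159, 118555999), (50565711, 202788301, 121503068, 114403292),
   (52699467, 193231411, 115074344, 110417615), (54951905, 184220932, 109044035, 106598052),
   (57330653, 175722690, 103384901, 102938936), (59846696, 167712661, 98081477, 99428827),
   (62510889, 160164431, 93118094, 96052466), (65336370, 153055917, 88463348, 92833172),
   (68329789, 146349056, 84097347, 89744840), (71497903, 140009620, 79996894, 86772919),
   (74849748, 134010749, 76140937, 83912187), (78395812, 128329612, 72512932, 81155509),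
   (82148872, 122947682, 69099555, 78496899), (86124235, 117849799, 65889614, 75932037),
   (90340358, 113023824, 62875004, 73455744), (94817987, 108458512, 60048343, 71062971),
   (99575815, 104138546, 57391725, 68762119), (104634647, 100050181, 54895701, 66549457),
   (110007078, 96171794, 52546603, 64412102), (115708769, 92486444, 50331054, 62347869),
   (121763677, 88984484, 48242308, 60353235), (128193777, 85654109, 46270727, 58426666),
   (135019003, 82482322, 44405522, 56566824), (142258106, 79456189, 42635570, 54773182),
   (149937801, 76567870, 40954948, 53043771), (158086289, 73809856, 39358546, 51375577),
   (166733238, 71174932, 37841828, 49764954), (175911709, 68656925, 36400938, 48208739),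
   (185657631, 66250190, 35032453, 46703828), (196003691, 63947460, 33730754, 45248638),
   (206983609, 61741863, 32490469, 43841812), (218637175, 59628311, 31307802, 42481978),
   (231008158, 57602395, 30179425, 41168021), (244139794, 55659144, 29102132, 39897586),
   (258083258, 53795073, 28074016, 38668361), (272892324, 52006630, 27091699, 37480669),
   (288615168, 50288800, 26152018, 36332319), (305306367, 48637663, 25252636, 35220914),
   (323021474, 47049278, 24390501, 34145608), (341822537, 45520496, 23563484, 33105121),
   (361775746, 44048433, 22769704, 32098124), (382954446, 42630738, 22007402, 31123997),
   (405441152, 41265612, 21275848, 30181029), (429311412, 39950077, 20573011, 29268026),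
   (454647419, 38681619, 19897206, 28383932), (481539023, 37458132, 19247097, 27527710),
   (510081498, 36277632, 18621367, 26698490), (540377481, 35138347, 18018942, 25895307),
   (572537056, 34038656, 17438882, 25117178), (606674625, 32976865, 16880085, 24363321),
   (642910696, 31951327, 16341472, 23632992), (681386253, 30961097, 15822729, 22925157),
   (722234539, 30004470, 15322654, 22239209), (765596874, 29079878, 14840194, 21574494),
   (811626646, 28186000, 14374553, 20930275), (860487444, 27321618, 13924964, 20305938),
   (912356148, 26485672, 13490757, 19700959), (967417298, 25677053, 13071309, 19114624),
   (1025866552, 24894701, 12666046, 18546218), (1087915220, 24137697, 12274443, 17995167),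
   (1153786565, 23405125, 11895972, 17460914), (1223714458, 22696052, 11530083, 16942913),
   (1297952203, 22009676, 11176351, 16440606), (1376763746, 21345144, 10834270, 15953496),
   (1460428789, 20701641, 10503357, 15481117), (1549252244, 20078499, 10183263, 15022983),
   (1643563734, 19475131, 9873721, 14578601), (1743689259, 18890683, 9574161, 14147601),
   (1849984972, 18324473, 9284189, 13729570), (1962837239, 17775929, 9003511, 13324085),
   (2082649171, 17244430, 8731771, 12930770), (2209848957, 16729388, 8468633, 12549257),
   (2344891666, 16230241, 8213789, 12179170), (2488260429, 15746453, 7966948, 11820150),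
   (2640470156, 15277521, 7727831, 11471867), (2802068042, 14822963, 7496172, 11134001),
   (2973633816, 14382307, 7271724, 10806215), (3155782639, 13955098, 7054249, 10488185),
   (3349167957, 13540898, 6843507, 10179618), (3554484529, 13139290, 6639270, 9880235),
   (3772471724, 12749876, 6441331, 9589749), (4003912276, 12372266, 6249488, 9307877),
   (4249632707, 12006069, 6063524, 9034361), (4510515825, 11650924, 5883244, 8768959),
   (4787505328, 11306499, 5708478, 8511423), (5081597482, 10972456, 5539051, 8261507),
   (5393839713, 10648449, 5374775, 8018976), (5725351568, 10334161, 5215480, 7783615),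
   (6077329623, 10029299, 5061010, 7555218), (6451040640, 9733573, 4911214, 7333576),
   (6847822589, 9446691, 4765944, 7118471), (7269094079, 9168372, 4625051, 6909705),
   (7716371742, 8898357, 4488391, 6707106), (8191271077, 8636399, 4355836, 6510500),
   (8695498555, 8382250, 4227265, 6319688), (9230853843, 8135659, 4102553, 6134482),
   (9799255307, 7896391, 3981571, 5954723), (10402755478, 7664233, 3864201, 5780268),
   (11043539805, 7438979, 3750348, 5610951), (11723897531, 7220408, 3639902, 5446601),
   (12446253019, 7008307, 3532746, 5287069), (13213205503, 6802482, 3428775, 5132234),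
   (14027559830, 6602768, 3327907, 4981963), (14892234837, 6408974, 3230049, 4836105),
   (15810293441, 6220901, 3135100, 4694512), (16785014295, 6038371, 3042963, 4557070),
   (17819944129, 5861235, 2953549, 4423683), (18918841078, 5689342, 2866793, 4294225),
   (20085606187, 5522519, 2782615, 4168544), (21324373797, 5360598, 2700926, 4046526),
   (22639622132, 5203444, 2621642, 3928103), (24036173626, 5050935, 2544699, 3813182),
   (25519052430, 4902930, 2470042, 3701627), (27093477862, 4759273, 2397597, 3593313),
   (28765023611, 4619823, 2327277, 3488165), (30539848163, 4484481, 2259023, 3386124),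
   (32424478957, 4353144, 2192793, 3287095), (34425532121, 4225669, 2128529, 3190940),
   (36549916572, 4101908, 2066154, 3097555), (38805446617, 3981777, 2005599, 3006925),
   (41200561694, 3865201, 1946821, 2919008), (43743857603, 3752069, 1889795, 2833659),
   (46444020985, 3642237, 1834454, 2750758), (49310662179, 3535607, 1780715, 2670292),
   (52354378117, 3432107, 1728533, 2592232), (55586709939, 3331682, 1677916, 2516461),
   (59018777233, 3234205, 1628807, 2442870), (62662029866, 3139543, 1581127, 2371383),
   (66529566257, 3047625, 1534827, 2301971), (70637377748, 2958462, 1489902, 2234668),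
   (74999728303, 2871944, 1446299, 2169378), (79630631557, 2787925, 1403990, 2105909),
   (84546258692, 2706326, 1362892, 2044293), (89767116327, 2627167, 1322966, 1984624),
   (95311104971, 2550343, 1284202, 1926731), (101197905199, 2475776, 1246681, 1870345),
   (107445800399, 2403333, 1210204, 1815615), (114078233029, 2332986, 1174785, 1762459),
   (121119428318, 2264685, 1140398, 1710850), (128604728818, 2198547, 1107159, 1660756),
   (136545906232, 2134235, 1074757, 1612205), (144976084709, 2071784, 1043312, 1565023),
   (153929570776, 2011138, 1012753, 1519194)]

/-- The wide end of the polygonal line, with the witnesses that `certifiedBetween` wants. -/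
def verticesBetween : List (ℕ × ℕ × ℕ × ℕ) :=
  [(153929570776, 2011138, 1535051, 117242560151), (163449755092, 1952549, 1490331, 124447377050),
   (173541486244, 1895421, 1446727, 132130772795), (184257101175, 1839973, 1404405, 140289376206),
   (195630897486, 1786114, 1363296, 148949391626), (207704992418, 1733818, 1323380, 158142278237),
   (220523923466, 1683050, 1284630, 167902396642), (234147868277, 1633865, 1247088, 178274829175),
   (248604036588, 1586057, 1210597, 189282051671), (263950681987, 1539637, 1175166, 200966460817),
   (280243240663, 1494567, 1140765, 213371648216), (297574690836, 1450978, 1104937, 227639166643),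
   (318453714654, 1419698, 1051086, 251878044884)]

/-- The first two entries bound the region on the left and from below, by the first coordinate of
the first vertex and the second coordinate of the last. The argument needs neither convexity of the
polygonal line nor that its vertices lie in the region; only the witnesses must lie there. -/
def halfPlanes : List (ℕ × ℕ × ℕ) :=
  (1, 0, 1012220) :: (0, 1, 1419698) :: (chords verticesBelow ++ chords verticesBetween)

theorem isStaircase_verticesBelow : isStaircase verticesBelow = true := by decide +kernel

theorem isStaircase_verticesBetween : isStaircase verticesBetween = true := by decide +kernel

theorem certifiedBelow_verticesBelow :
    verticesBelow.all (certifiedBelow halfPlanes) = true := by decide +kernel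

theorem certifiedBetween_verticesBetween :
    verticesBetween.all (certifiedBetween halfPlanes) = true := by decide +kernel

/-- One of the vertices in `verticesBelow`; another point of the region would only change the
constant `C`. -/
theorem mem_region_halfPlanes : ((82148872 : ℝ), (122947682 : ℝ)) ∈ region halfPlanes := by
  have := mem_region_of_inRegion (H := halfPlanes) (x := 82148872) (y := 122947682) (by decide +kernel)
  exact_mod_cast this

theorem halfPlanes_bounds {p : ℝ × ℝ} (hp : p ∈ region halfPlanes) :
    1012220 ≤ p.1 ∧ 1419698 ≤ p.2 := by
  have h1 := hp (1, 0, 1012220) (by simp [halfPlanes])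
  have h2 := hp (0, 1, 1419698) (by simp [halfPlanes])
  norm_num at h1 h2
  exact ⟨h1, h2⟩

/-! ### The induction on the layers and the area bound. -/

/-- Only certificates for the same rule can be averaged, hence the two lists: one rule serves the
narrow part of the line, the other the wide part. The vertex where they join is in both lists, with
a certificate for each rule. -/
theorem DrawableOn.succ {l : ℕ} (hl : 1 ≤ l) {c : ℝ} (hc : 0 ≤ c)
    (hd : DrawableOn halfPlanes l c) : DrawableOn halfPlanes (l + 1) (c * growth) := by
  intro p hp
  obtain ⟨hp1, hp2⟩ := halfPlanes_bounds hp
  have hA : ∀ v ∈ verticesBelow, certifiedBelow halfPlanes v = true :=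
    List.all_eq_true.1 certifiedBelow_verticesBelow
  have hB : ∀ v ∈ verticesBetween, certifiedBetween halfPlanes v = true :=
    List.all_eq_true.1 certifiedBetween_verticesBetween
  rcases exists_chord_le verticesBelow.tail (verticesBelow.headI) isStaircase_verticesBelow p
    (fun t ht => hp t (by
      simp only [halfPlanes, List.mem_cons, List.mem_append]
      exact Or.inr (Or.inr (Or.inl ht)))) (by
      have : verticesBelow.headI.1 = 1012220 := rfl
      rw [this]
      exact_mod_cast hp1) with ⟨v, hv, w, hw, a, b, ha, hb, hab, hx, hy⟩ | h
  · exact hd.below hl hc (hA v hv) (hA w hw) ha hb hab hx hy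
  rcases exists_chord_le verticesBetween.tail (verticesBetween.headI) isStaircase_verticesBetween p
    (fun t ht => hp t (by
      simp only [halfPlanes, List.mem_cons, List.mem_append]
      exact Or.inr (Or.inr (Or.inr ht)))) (by
      refine le_trans (le_of_eq ?_) h
      norm_cast) with ⟨v, hv, w, hw, a, b, ha, hb, hab, hx, hy⟩ | h'
  · exact hd.between hl hc (hB v hv) (hB w hw) ha hb hab hx hy
  -- To the right of the line, `p` dominates the last vertex because of the half plane `(0, 1,
  -- 1419698)`; the weights are 1 and 0.
  · have hL := hB _ (List.getLast_mem (l := verticesBetween) (by decide))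
    refine hd.between hl hc hL hL zero_le_one le_rfl (add_zero 1) ?_ ?_
    · rw [one_mul, zero_mul, add_zero]
      exact h'
    · rw [one_mul, zero_mul, add_zero]
      refine le_trans (le_of_eq ?_) hp2
      norm_cast

theorem drawableOn_halfPlanes (l : ℕ) : DrawableOn halfPlanes (l + 1) (2 * growth ^ l) := by
  induction l with
  | zero =>
    intro p hp
    obtain ⟨hp1, hp2⟩ := halfPlanes_bounds hp
    -- Both coordinates in the region exceed a million, so the base case has ample room.
    exact drawableWithin_one (by linarith) (by linarith)
  | succ l ih =>
    have := ih.succ (by omega) (by unfold growth; positivity)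
    rwa [mul_assoc, ← pow_succ] at this

/-- The leaves alone, the lists of length exactly `l`, number `3 ^ l`. -/
theorem pow_le_card_ternaryNode (l : ℕ) : 3 ^ l ≤ Nat.card (TernaryNode (l + 1)) := by
  have h := Nat.card_le_card_of_injective
    (fun f : Fin l → Fin 3 => (⟨List.ofFn f, by simp⟩ : TernaryNode (l + 1)))
    (fun f g h => List.ofFn_injective (congrArg Subtype.val h))
  rwa [show Nat.card (Fin l → Fin 3) = 3 ^ l by simp] at h

theorem mainTheorem3 :
    ∃ C : ℝ, ∀ l : ℕ, 1 ≤ l →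
      ∃ (w h : ℕ) (Γ : StraightLineOrthogonalDrawing (completeTernaryTree l) w h),
        SubtreeSeparated Γ ∧
          ((w * h : ℕ) : ℝ) ≤ C * (Nat.card (TernaryNode l) : ℝ) ^ (1.032 : ℝ) := by
  -- One factor 2 comes from `2 * m + 1 ≤ 2 * (m + 1)`, the other two from the scale `2 * growth ^
  -- l` in each dimension.
  refine ⟨8 * 82148872 * 122947682, fun l hl => ?_⟩
  obtain ⟨l, rfl⟩ : ∃ k, l = k + 1 := ⟨l - 1, by omega⟩
  obtain ⟨m, h, d, hm, hh⟩ := drawableOn_halfPlanes l _ mem_region_halfPlanes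
  obtain ⟨Γ, hΓ⟩ := d.exists_drawing
  obtain ⟨hm0, hh0⟩ := d.nonneg hl
  refine ⟨_, _, Γ, hΓ, ?_⟩
  have hg : 0 ≤ growth := by unfold growth; norm_num
  have e1 : (((2 * m + 1).toNat : ℕ) : ℝ) = 2 * m + 1 := by
    have : (((2 * m + 1).toNat : ℤ) : ℝ) = ((2 * m + 1 : ℤ) : ℝ) := by
      rw [Int.toNat_of_nonneg (by omega)]
    exact_mod_cast this
  have e2 : ((h.toNat : ℕ) : ℝ) = h := by
    have : ((h.toNat : ℤ) : ℝ) = (h : ℝ) := by rw [Int.toNat_of_nonneg hh0]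
    exact_mod_cast this
  have hm0' : (0 : ℝ) ≤ m := by exact_mod_cast hm0
  have hh0' : (0 : ℝ) ≤ h := by exact_mod_cast hh0
  have hcard : (growth ^ 2) ^ l ≤ (Nat.card (TernaryNode (l + 1)) : ℝ) ^ (1.032 : ℝ) := by
    calc (growth ^ 2) ^ l ≤ ((3 : ℝ) ^ (1.032 : ℝ)) ^ l :=
          pow_le_pow_left₀ (by positivity) growth_sq_le l
      _ = ((3 : ℝ) ^ l) ^ (1.032 : ℝ) := by
          rw [← Real.rpow_natCast, ← Real.rpow_natCast, ← Real.rpow_mul (by norm_num),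
            ← Real.rpow_mul (by norm_num), mul_comm]
      _ ≤ _ := by
          refine Real.rpow_le_rpow (by positivity) ?_ (by norm_num)
          exact_mod_cast pow_le_card_ternaryNode l
  calc (((2 * m + 1).toNat * h.toNat : ℕ) : ℝ) = (2 * m + 1) * h := by
        rw [Nat.cast_mul, e1, e2]
    _ ≤ (2 * (2 * growth ^ l * 82148872)) * (2 * growth ^ l * 122947682) :=
        mul_le_mul (by linarith) (by linarith) hh0' (by positivity)
    _ = 8 * 82148872 * 122947682 * (growth ^ 2) ^ l := by ring
    _ ≤ _ := mul_le_mul_of_nonneg_left hcard (by norm_num)
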